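/- Let $p\colon\mathbb R^n\to[1,\infty)$ be measurable with $1<p^-\le p^+<\infty$, where $p^-_S=\operatorname{ess\,inf}_S p$, $p^+_S=\operatorname{ess\,sup}_S p$, $p^\pm=p^\pm_{\mathbb R^n}$, and assume that $1/p$ is log-Hölder continuous: there is $L\ge 0$ with $\left|\frac1{p(x)}-\frac1{p(y)}\right|\le \frac{L}{\log(e+1/|x-y|)}$ for all $x\neq y$ in $\mathbb R^n$. Let $\mathcal A\colon\mathbb R^n\times\mathbb R\times\mathbb R^n\to\mathbb R^n$ be a Carathéodory function ($\mathcal A(x,t,\xi)$ is measurable in $x$ and continuous in $(t,\xi)$) of $p(\cdot)$-growth: there are measurable functions $a\le b$ on $\mathbb R^n$ and constants $a_->0$, $b^+<\infty$ with $a_-\le a$ and $b\le b^+$, such that for all $(x,t,\xi)$ $$\langle\mathcal A(x,t,\xi),\xi\rangle\ge a(x)|\xi|^{p(x)},\qquad |\mathcal A(x,t,\xi)|\le b(x)|\xi|^{p(x)-1}.$$ A function $u$ is called $\mathcal A$-harmonic in $\mathbb R^n$ if it is continuous, belongs to $W^{1,p(\cdot)}_{\mathrm{loc}}(\mathbb R^n)$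 (i.e. $u$ and its distributional gradient $\nabla u$ belong to $L^{p(\cdot)}(\Omega')$ for every bounded open set $\Omega'$, where $f\in L^{p(\cdot)}(\Omega')$ means that $f$ is measurable and $\int_{\Omega'}|f(x)/\mu|^{p(x)}\,dx<\infty$ for some $\mu>0$), and satisfies $$\int_{\mathbb R^n}\langle\mathcal A(x,u,\nabla u),\nabla\phi\rangle\,dx=0\qquad\text{for all }\phi\in C_0^\infty(\mathbb R^n).$$ Let $x_0\in\mathbb R^n$ and write $B_r=\{x:|x-x_0|<r\}$. Suppose that there are $\delta>0$ and a sequence of real numbers $R_k\to\infty$ such that $$p^-_{B_{2R_k}\setminus B_{R_k}}\ge n+\delta\qquad\text{for all }k.$$ Then every bounded $\mathcal A$-harmonic function in $\mathbb R^n$ is constant. -/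

import Mathlib

open MeasureTheory Set Filter Metric
open scoped ContDiff ENNReal

namespace VarExp

/-- Euclidean space `ℝⁿ` with its Euclidean norm, inner product and Lebesgue measure. -/
abbrev Rn (n : ℕ) : Type := EuclideanSpace ℝ (Fin n)

variable {n : ℕ}

/-! ### Variable exponents

Measurability always means Lebesgue measurability, i.e. a.e.-measurability with respect to the
Lebesgue measure. Exponents are finite-valued, as only bounded exponents are considered. -/

/-- A (finite-valued) variable exponent on `Ω`: a measurable function with values in `[1, ∞)`. -/
structure IsVariableExponent (Ω : Set (Rn n)) (p : Rn n → ℝ) : Prop where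
  aemeasurable : AEMeasurable p (volume.restrict Ω)
  one_le : ∀ x ∈ Ω, 1 ≤ p x

/-- `p⁺_S`, the essential supremum of `p` over `S`, as an extended real number. -/
noncomputable def pPlus (p : Rn n → ℝ) (S : Set (Rn n)) : EReal :=
  essSup (fun x => (p x : EReal)) (volume.restrict S)

/-- `p⁻_S`, the essential infimum of `p` over `S`, as an extended real number. -/
noncomputable def pMinus (p : Rn n → ℝ) (S : Set (Rn n)) : EReal :=
  essInf (fun x => (p x : EReal)) (volume.restrict S)

/-- `α` is log-Hölder continuous on `Ω`:
`|α(x) - α(y)| ≤ L / log (e + 1 / |x - y|)` for all `x, y ∈ Ω`.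
(For `x = y` the left-hand side vanishes, so the convention for `1 / 0` is immaterial.) -/
def LogHolderOn (Ω : Set (Rn n)) (α : Rn n → ℝ) : Prop :=
  ∃ L : ℝ, 0 ≤ L ∧ ∀ x ∈ Ω, ∀ y ∈ Ω,
    |α x - α y| ≤ L / Real.log (Real.exp 1 + 1 / ‖x - y‖)

/-- The class `𝒫^log(Ω)`: variable exponents `p` for which `1 / p` is log-Hölder continuous. -/
structure IsLogExponent (Ω : Set (Rn n)) (p : Rn n → ℝ) : Prop where
  isVariableExponent : IsVariableExponent Ω p
  logHolder : LogHolderOn Ω (fun x => 1 / p x)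

/-! ### Variable exponent Lebesgue and Sobolev spaces -/

/-- The modular `∫_Ω |f(x)|^{p(x)} dx`, for scalar or vector valued `f`. -/
noncomputable def modular {F : Type*} [NormedAddCommGroup F]
    (Ω : Set (Rn n)) (p : Rn n → ℝ) (f : Rn n → F) : ℝ≥0∞ :=
  ∫⁻ x in Ω, ENNReal.ofReal (‖f x‖ ^ p x)

/-- `f ∈ L^{p(·)}(Ω)`: `f` is measurable on `Ω` and the modular of `f / μ` is finite for some
`μ > 0`. -/
def MemLpVar {F : Type*} [NormedAddCommGroup F] [NormedSpace ℝ F]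
    (Ω : Set (Rn n)) (p : Rn n → ℝ) (f : Rn n → F) : Prop :=
  AEStronglyMeasurable f (volume.restrict Ω) ∧
    ∃ μ : ℝ, 0 < μ ∧ modular Ω p (fun x => μ⁻¹ • f x) < ⊤

/-- `f ∈ L^{p(·)}_loc(Ω)`: `f ∈ L^{p(·)}(Ω')` for all open `Ω'` compactly contained in `Ω`. -/
def MemLpVarLoc {F : Type*} [NormedAddCommGroup F] [NormedSpace ℝ F]
    (Ω : Set (Rn n)) (p : Rn n → ℝ) (f : Rn n → F) : Prop :=
  ∀ Ω' : Set (Rn n), IsOpen Ω' → IsCompact (closure Ω') → closure Ω' ⊆ Ω → MemLpVar Ω' p f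

/-- `φ ∈ C_0^∞(Ω)`: smooth functions with compact support contained in `Ω`. -/
structure IsTestFunction (Ω : Set (Rn n)) (φ : Rn n → ℝ) : Prop where
  contDiff : ContDiff ℝ ∞ φ
  hasCompactSupport : HasCompactSupport φ
  tsupport_subset : tsupport φ ⊆ Ω

/-- `G` is the distributional gradient of `u` on the open set `Ω`: both are locally integrable and
`∫_Ω u ∇φ = - ∫_Ω φ G` for all `φ ∈ C_0^∞(Ω)`. -/
structure IsWeakGradient (Ω : Set (Rn n)) (u : Rn n → ℝ) (G : Rn n → Rn n) : Prop where
  locallyIntegrableOn : LocallyIntegrableOn u Ω volume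
  locallyIntegrableOn_grad : LocallyIntegrableOn G Ω volume
  integral_eq : ∀ φ : Rn n → ℝ, IsTestFunction Ω φ →
    ∫ x in Ω, u x • gradient φ x = - ∫ x in Ω, φ x • G x

/-- `u ∈ W^{1,p(·)}_loc(Ω)` with distributional gradient `G` (which is unique a.e. on `Ω`). -/
structure MemSobolevLoc (Ω : Set (Rn n)) (p : Rn n → ℝ) (u : Rn n → ℝ) (G : Rn n → Rn n) :
    Prop where
  memLpVarLoc : MemLpVarLoc Ω p u
  isWeakGradient : IsWeakGradient Ω u G
  memLpVarLoc_grad : MemLpVarLoc Ω p G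

/-! ### Operators of `p(·)`-growth and `𝒜`-harmonic functions -/

/-- `A : Ω × ℝ × ℝⁿ → ℝⁿ` is a Carathéodory function: measurable in the first argument and
continuous in the latter two. -/
structure IsCaratheodory (Ω : Set (Rn n)) (A : Rn n → ℝ → Rn n → Rn n) : Prop where
  aemeasurable : ∀ (t : ℝ) (ξ : Rn n), AEMeasurable (fun x => A x t ξ) (volume.restrict Ω)
  continuous : ∀ x ∈ Ω, Continuous (fun q : ℝ × Rn n => A x q.1 q.2)

/-- The Carathéodory function `A` is of nonstandard growth, or `p(·)`-growth, on `Ω`. -/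
structure HasVarGrowth (Ω : Set (Rn n)) (p : Rn n → ℝ) (A : Rn n → ℝ → Rn n → Rn n) : Prop where
  isCaratheodory : IsCaratheodory Ω A
  bounds : ∃ (a b : Rn n → ℝ) (aMinus bPlus : ℝ),
    AEMeasurable a (volume.restrict Ω) ∧ AEMeasurable b (volume.restrict Ω) ∧
    0 < aMinus ∧ (∀ x ∈ Ω, aMinus ≤ a x) ∧ (∀ x ∈ Ω, a x ≤ b x) ∧ (∀ x ∈ Ω, b x ≤ bPlus) ∧
    (∀ x ∈ Ω, ∀ (t : ℝ) (ξ : Rn n), a x * ‖ξ‖ ^ p x ≤ inner ℝ (A x t ξ) ξ) ∧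
    (∀ x ∈ Ω, ∀ (t : ℝ) (ξ : Rn n), ‖A x t ξ‖ ≤ b x * ‖ξ‖ ^ (p x - 1))

/-- `u` is a weak solution of `-div A(x, u, ∇u) = 0` on `Ω`: `u ∈ W^{1,p(·)}_loc(Ω)` and
`∫_Ω ⟨A(x, u, ∇u), ∇φ⟩ dx = 0` for all `φ ∈ C_0^∞(Ω)`. -/
def IsWeakSolution (Ω : Set (Rn n)) (p : Rn n → ℝ) (A : Rn n → ℝ → Rn n → Rn n)
    (u : Rn n → ℝ) : Prop :=
  ∃ G : Rn n → Rn n, MemSobolevLoc Ω p u G ∧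
    ∀ φ : Rn n → ℝ, IsTestFunction Ω φ →
      ∫ x in Ω, inner ℝ (A x (u x) (G x)) (gradient φ x) = 0

/-- An `𝒜`-harmonic function on `Ω` is a continuous weak solution. -/
structure IsAHarmonic (Ω : Set (Rn n)) (p : Rn n → ℝ) (A : Rn n → ℝ → Rn n → Rn n)
    (u : Rn n → ℝ) : Prop where
  continuousOn : ContinuousOn u Ω
  isWeakSolution : IsWeakSolution Ω p A u

end VarExp

open scoped Topology Convolution

/-! The engine is a Caccioppoli inequality (`exists_caccioppoli`). Testing the equation with `ζ ^ q
* u` and using `|u| ≤ M` with Young's inequality gives `∫ ζ ^ q |∇u| ^ p ≤ C ∫ |∇ζ| ^ p`, with `C`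
independent of the cut-off `ζ`. If `ζ` drops from 1 to 0 across the annulus of radii `R`, `2R`, then
`|∇ζ|` is of order `1 / R` there. Where `p ≥ n + δ`, the right side is at most a constant times `R ^
n * R ^ (-(n + δ)) = R ^ (-δ)`. Letting `R = R_k → ∞` forces `∇u = 0` a.e., so `u` is constant.

The delicate point is that `ζ ^ q * u` is not smooth. In `integral_cutoff_eq`, `u` is mollified, and
the limit rests on the pointwise bound `|ρ * G| ^ p(x) ≤ C (ρ * |G| ^ p + 1)` of
`exists_norm_convolution_rpow_le`; this is where log-Hölder continuity enters quantitatively. The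
resulting majorants converge in `L¹` by Scheffé's lemma, so a generalized dominated convergence
theorem applies and no norm on `L^{p(·)}` is needed. -/

namespace VarExp

variable {n : ℕ}

/-! ### Continuity and pointwise bounds for the exponent -/

section Exponent

/-- The modulus increases with distance, so it may be evaluated at the mollification radius instead
of at `‖x - y‖`. -/
lemma LogHolderOn.exists_le {α : Rn n → ℝ} (h : LogHolderOn univ α) :
    ∃ L : ℝ, 0 ≤ L ∧ ∀ x y : Rn n, ∀ ε : ℝ, 0 < ε → ‖x - y‖ ≤ ε →
      |α x - α y| ≤ L / Real.log (Real.exp 1 + 1 / ε) := by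
  obtain ⟨L, hL, h⟩ := h
  refine ⟨L, hL, fun x y ε hε hxy => ?_⟩
  have he : 1 < Real.exp 1 := by simp
  have hlog : 0 < Real.log (Real.exp 1 + 1 / ε) :=
    Real.log_pos (lt_add_of_lt_of_nonneg he (by positivity))
  rcases eq_or_ne x y with rfl | hne
  · simpa using div_nonneg hL hlog.le
  have hpos : 0 < ‖x - y‖ := norm_pos_iff.2 (sub_ne_zero.2 hne)
  refine (h x trivial y trivial).trans ?_
  gcongr

lemma LogHolderOn.continuous {α : Rn n → ℝ} (h : LogHolderOn univ α) : Continuous α := by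
  obtain ⟨L, hL, h⟩ := h
  refine continuous_iff_continuousAt.2 fun y => ?_
  rw [continuousAt_iff_punctured_nhds, tendsto_iff_dist_tendsto_zero]
  refine squeeze_zero (fun _ => dist_nonneg) (fun x => h x trivial y trivial) ?_
  refine Tendsto.const_div_atTop (Real.tendsto_log_atTop.comp
    (tendsto_atTop_add_const_left _ _ ?_)) L
  simp only [one_div]
  refine tendsto_inv_nhdsGT_zero.comp ?_
  exact tendsto_norm_sub_self_nhdsNE y

lemma IsLogExponent.continuous {p : Rn n → ℝ} (hp : IsLogExponent univ p) : Continuous p := by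
  have h := hp.logHolder.continuous
  have h1 : ∀ x, 1 / p x ≠ 0 := fun x =>
    (one_div_pos.2 (one_pos.trans_le (hp.isVariableExponent.one_le x trivial))).ne'
  have h2 : p = fun x => (1 / p x)⁻¹ := by simp
  rw [h2]
  exact h.inv₀ h1

/-- A set of full measure is dense, so continuity upgrades the essential bound to one at every
point. -/
lemma exists_forall_le_of_pPlus_lt_top {p : Rn n → ℝ} (hp : Continuous p)
    (h : pPlus p univ < ⊤) : ∃ P : ℝ, ∀ x, p x ≤ P := by
  obtain ⟨P, hP, -⟩ := EReal.lt_iff_exists_real_btwn.1 h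
  refine ⟨P, fun x => ?_⟩
  have hae : ∀ᵐ x : Rn n, p x ≤ P := by
    have := ae_le_essSup (f := fun x => (p x : EReal)) (μ := volume.restrict (univ : Set (Rn n)))
    rw [Measure.restrict_univ] at this
    filter_upwards [this] with x hx
    have h2 := hx.trans_lt (by simpa [pPlus] using hP)
    exact_mod_cast h2.le
  have hd := Measure.dense_of_ae hae
  have hc : IsClosed {x | p x ≤ P} := isClosed_le hp continuous_const
  exact hc.closure_eq.subset (hd x)

lemma ae_le_of_le_pMinus {p : Rn n → ℝ} {S : Set (Rn n)} {c : ℝ}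
    (h : (c : EReal) ≤ pMinus p S) : ∀ᵐ x ∂volume.restrict S, c ≤ p x := by
  filter_upwards [ae_essInf_le (f := fun x => (p x : EReal)) (μ := volume.restrict S)] with x hx
  exact_mod_cast h.trans hx

end Exponent

/-! ### Young-type inequalities with constants uniform in the exponent -/

section Elementary

lemma rpow_sub_one_mul_le {s t p : ℝ} (hs : 0 ≤ s) (ht : 0 ≤ t) (hp : 1 ≤ p) :
    s ^ (p - 1) * t ≤ s ^ p + t ^ p := by
  have key : ∀ r : ℝ, 0 ≤ r → r ^ (p - 1) * r = r ^ p := fun r hr => by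
    rw [← Real.rpow_add_one' hr (by linarith)]; simp
  have hs' := Real.rpow_nonneg hs p
  have ht' := Real.rpow_nonneg ht p
  rcases le_total s t with h | h
  · have : s ^ (p - 1) * t ≤ t ^ (p - 1) * t := by gcongr
    rw [key t ht] at this; linarith
  · have : s ^ (p - 1) * t ≤ s ^ (p - 1) * s := by gcongr
    rw [key s hs] at this; linarith

/-- Above the threshold `l` one has `(s / l) ^ (p - 1) ≥ 1`. The free choice of `l` lets this
replace Jensen's inequality when the exponent varies under the integral. -/
lemma le_add_rpow_mul {s l p : ℝ} (hs : 0 ≤ s) (hl : 0 < l) (hp : 1 ≤ p) :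
    s ≤ l + l ^ (1 - p) * s ^ p := by
  rcases le_total s l with h | h
  · have := Real.rpow_nonneg hs p
    have := Real.rpow_nonneg hl.le (1 - p)
    nlinarith [mul_nonneg this (Real.rpow_nonneg hs p)]
  · have hs0 : 0 < s := hl.trans_le h
    have h1 : s ^ (1 - p) ≤ l ^ (1 - p) := Real.rpow_le_rpow_of_nonpos hl h (by linarith)
    have h2 : s = s ^ (1 - p) * s ^ p := by rw [← Real.rpow_add hs0]; simp
    have h3 : s ^ (1 - p) * s ^ p ≤ l ^ (1 - p) * s ^ p := by gcongr
    linarith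

/-- A weighted Young inequality with a cut-off factor. -/
lemma pow_mul_rpow_mul_le {η s t τ p P : ℝ} {q : ℕ} (hη : 0 ≤ η) (hη1 : η ≤ 1) (hs : 0 ≤ s)
    (ht : 0 ≤ t) (hτ : 0 < τ) (hτ1 : τ ≤ 1) (hp : 1 ≤ p) (hpP : p ≤ P) (hq : P ≤ q) :
    η ^ (q - 1) * s ^ (p - 1) * t ≤ τ * (η ^ q * s ^ p) + τ ^ (-P) * t ^ p := by
  have key : ∀ r : ℝ, 0 ≤ r → r ^ (p - 1) * r = r ^ p := fun r hr => by
    rw [← Real.rpow_add_one' hr (by linarith)]; simp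
  have hq1 : 1 ≤ q := by exact_mod_cast (hp.trans (hpP.trans hq))
  have hsp := Real.rpow_nonneg hs p
  have htp := Real.rpow_nonneg ht p
  have hsp1 := Real.rpow_nonneg hs (p - 1)
  -- If `t` is small against `τ * η * s`, the first term on the right suffices; otherwise `η * s ≤ t
  -- / τ` and the second does.
  rcases le_total t (τ * (η * s)) with h | h
  · have h1 : η ^ (q - 1) * s ^ (p - 1) * t ≤ η ^ (q - 1) * s ^ (p - 1) * (τ * (η * s)) := by
      gcongr
    have h2 : η ^ (q - 1) * s ^ (p - 1) * (τ * (η * s)) = τ * (η ^ q * s ^ p) := by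
      rw [← key s hs]
      obtain ⟨m, rfl⟩ : ∃ m, q = m + 1 := ⟨q - 1, by omega⟩
      simp only [Nat.add_sub_cancel, pow_succ]; ring
    have : 0 ≤ τ ^ (-P) * t ^ p := by positivity
    linarith
  -- This uses `p ≤ q` and `η ≤ 1`. The value `η = 0` is separate: for `p = 1` the right side is
  -- then `0 ^ 0 = 1`.
  · have h0 : η ^ (q - 1) ≤ η ^ (p - 1) := by
      rw [← Real.rpow_natCast]
      rcases hη.eq_or_lt with rfl | hη0
      · rcases hp.eq_or_lt with rfl | hp1
        · simp only [sub_self, Real.rpow_zero]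
          exact Real.rpow_le_one le_rfl zero_le_one (by positivity)
        · have hq2 : 1 < (q : ℝ) := hp1.trans_le (hpP.trans hq)
          rw [Real.zero_rpow (x := p - 1) (by linarith), Real.zero_rpow]
          rw [Nat.cast_sub hq1, Nat.cast_one]; linarith
      · refine Real.rpow_le_rpow_of_exponent_ge hη0 hη1 ?_
        rw [Nat.cast_sub hq1]; push_cast; linarith
    have h3 : η * s ≤ τ⁻¹ * t := by
      rw [inv_mul_eq_div, le_div_iff₀ hτ]; linarith
    have h4 : η ^ (q - 1) * s ^ (p - 1) ≤ (τ⁻¹ * t) ^ (p - 1) :=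
      calc _ ≤ η ^ (p - 1) * s ^ (p - 1) := by gcongr
        _ = (η * s) ^ (p - 1) := (Real.mul_rpow hη hs).symm
        _ ≤ _ := by gcongr
    have h5 : (τ⁻¹ * t) ^ (p - 1) * t = τ ^ (-(p - 1)) * t ^ p := by
      rw [Real.mul_rpow (by positivity) ht, Real.inv_rpow hτ.le, ← Real.rpow_neg hτ.le, mul_assoc,
        key t ht]
    have h6 : τ ^ (-(p - 1)) ≤ τ ^ (-P) :=
      Real.rpow_le_rpow_of_exponent_ge hτ hτ1 (by linarith)
    calc η ^ (q - 1) * s ^ (p - 1) * t ≤ (τ⁻¹ * t) ^ (p - 1) * t := by gcongr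
      _ = τ ^ (-(p - 1)) * t ^ p := h5
      _ ≤ τ ^ (-P) * t ^ p := by gcongr
      _ ≤ _ := by
        have : 0 ≤ τ * (η ^ q * s ^ p) := by positivity
        linarith

end Elementary

/-! ### Convergence of integrals and measurability of superpositions -/

section Limits

variable {X : Type*} [MeasurableSpace X] {μ : Measure X}

/-- Scheffé's lemma. -/
lemma tendsto_integral_abs_sub_of_ae {F : X → ℝ} {Fk : ℕ → X → ℝ}
    (hF : Integrable F μ) (hFk : ∀ k, Integrable (Fk k) μ) (hpos : ∀ k x, 0 ≤ Fk k x)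
    (hae : ∀ᵐ x ∂μ, Tendsto (fun k => Fk k x) atTop (𝓝 (F x)))
    (hint : Tendsto (fun k => ∫ x, Fk k x ∂μ) atTop (𝓝 (∫ x, F x ∂μ))) :
    Tendsto (fun k => ∫ x, |Fk k x - F x| ∂μ) atTop (𝓝 0) := by
  have hmax : Tendsto (fun k => ∫ x, max (F x - Fk k x) 0 ∂μ) atTop (𝓝 0) := by
    have := tendsto_integral_of_dominated_convergence (μ := μ)
      (F := fun k x => max (F x - Fk k x) 0) (f := fun _ => (0 : ℝ)) (fun x => |F x|)
      (fun k => ((hF.sub (hFk k)).sup (integrable_zero _ _ _)).aestronglyMeasurable) hF.abs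
      (fun k => Eventually.of_forall fun x => by
        rw [Real.norm_of_nonneg (le_max_right _ _)]
        exact max_le (by linarith [hpos k x, le_abs_self (F x)]) (abs_nonneg _))
      (by
        filter_upwards [hae] with x hx
        simpa using (hx.const_sub (F x)).max (tendsto_const_nhds (x := (0 : ℝ))))
    simpa using this
  -- Integrates `|s| = 2 * max (-s) 0 + s` with `s = Fk - F`: only the negative part of `s` needs
  -- domination, and `F` provides it.
  have hid : ∀ k, ∫ x, |Fk k x - F x| ∂μ
      = 2 * (∫ x, max (F x - Fk k x) 0 ∂μ) + ((∫ x, Fk k x ∂μ) - ∫ x, F x ∂μ) := by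
    intro k
    have hi : Integrable (fun x => max (F x - Fk k x) 0) μ :=
      (hF.sub (hFk k)).sup (integrable_zero _ _ _)
    rw [← integral_sub (hFk k) hF, ← integral_const_mul,
      ← integral_add (hi.const_mul 2) (by exact (hFk k).sub hF)]
    congr 1; ext x
    rcases le_total (F x) (Fk k x) with h | h
    · rw [max_eq_right (by linarith), abs_of_nonneg (by linarith)]; ring
    · rw [max_eq_left (by linarith), abs_of_nonpos (by linarith)]; ring
  simp_rw [hid]
  simpa using (hmax.const_mul 2).add (hint.sub_const (∫ x, F x ∂μ))

/-- Dominated convergence with a sequence of majorants converging in `L¹`. -/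
lemma tendsto_integral_of_dominated_of_tendsto_integral_abs {h : X → ℝ} {hk : ℕ → X → ℝ}
    {g : X → ℝ} {gk : ℕ → X → ℝ} (hkm : ∀ k, AEStronglyMeasurable (hk k) μ)
    (hg : Integrable g μ) (hgk : ∀ k, Integrable (gk k) μ)
    (hle : ∀ k, ∀ᵐ x ∂μ, |hk k x| ≤ gk k x)
    (hae : ∀ᵐ x ∂μ, Tendsto (fun k => hk k x) atTop (𝓝 (h x)))
    (gae : ∀ᵐ x ∂μ, Tendsto (fun k => gk k x) atTop (𝓝 (g x)))
    (hL : Tendsto (fun k => ∫ x, |gk k x - g x| ∂μ) atTop (𝓝 0)) :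
    Tendsto (fun k => ∫ x, hk k x ∂μ) atTop (𝓝 (∫ x, h x ∂μ)) := by
  have hhg : ∀ᵐ x ∂μ, |h x| ≤ g x := by
    filter_upwards [hae, gae, ae_all_iff.2 hle] with x h1 h2 h3
    exact le_of_tendsto_of_tendsto' h1.abs h2 h3
  have hhk : ∀ k, Integrable (hk k) μ := fun k => (hgk k).mono' (hkm k) (hle k)
  -- Clipping to `[-g, g]` brings the fixed majorant `g` into play, and the part cut off is at most
  -- `|gk - g|`, which tends to 0 in `L¹`.
  set ck : ℕ → X → ℝ := fun k x => max (-g x) (min (hk k x) (g x)) with hck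
  have hckm : ∀ k, AEStronglyMeasurable (ck k) μ := fun k =>
    hg.aestronglyMeasurable.neg.sup ((hkm k).inf hg.aestronglyMeasurable)
  have hckle : ∀ k, ∀ᵐ x ∂μ, ‖ck k x‖ ≤ g x := fun k => by
    filter_upwards [hhg] with x hx
    have : 0 ≤ g x := (abs_nonneg _).trans hx
    rw [Real.norm_eq_abs, abs_le]
    exact ⟨le_max_left _ _, max_le (by linarith) (min_le_right _ _)⟩
  have hcki : ∀ k, Integrable (ck k) μ := fun k => hg.mono' (hckm k) (hckle k)
  have h1 : Tendsto (fun k => ∫ x, ck k x ∂μ) atTop (𝓝 (∫ x, h x ∂μ)) := by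
    refine tendsto_integral_of_dominated_convergence g hckm hg hckle ?_
    filter_upwards [hhg, hae] with x hx h1
    have h2 : max (-g x) (min (h x) (g x)) = h x := by
      rw [abs_le] at hx
      rw [min_eq_left hx.2, max_eq_right hx.1]
    have h3 := (tendsto_const_nhds (x := -g x)).max (h1.min (tendsto_const_nhds (x := g x)))
    rwa [h2] at h3
  have h2 : Tendsto (fun k => ∫ x, (hk k x - ck k x) ∂μ) atTop (𝓝 0) := by
    refine squeeze_zero_norm (fun k => (norm_integral_le_integral_norm _).trans ?_) hL
    refine integral_mono_ae ((hhk k).sub (hcki k)).norm ((hgk k).sub hg).abs ?_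
    filter_upwards [hle k, hhg] with x hx hgx
    have hg0 : 0 ≤ g x := (abs_nonneg _).trans hgx
    simp only [hck, Real.norm_eq_abs]
    rw [abs_le] at hx
    have h4 := le_abs_self (gk k x - g x)
    have h5 := abs_nonneg (gk k x - g x)
    rcases le_total (hk k x) (g x) with h | h
    · rw [min_eq_left h]
      rcases le_total (-g x) (hk k x) with h' | h'
      · rw [max_eq_right h']; simp
      · rw [max_eq_left h', abs_le]; constructor <;> linarith
    · rw [min_eq_right h, max_eq_right (by linarith), abs_le]; constructor <;> linarith
  have h3 := h1.add h2
  rw [add_zero] at h3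
  refine h3.congr fun k => ?_
  rw [integral_sub (hhk k) (hcki k)]; ring

/-- Superposition with a Carathéodory function preserves a.e.-measurability. -/
lemma aemeasurable_comp_of_caratheodory {Y Z : Type*} [TopologicalSpace Y]
    [TopologicalSpace.PseudoMetrizableSpace Y]
    [TopologicalSpace Z] [TopologicalSpace.PseudoMetrizableSpace Z] [MeasurableSpace Z]
    [BorelSpace Z] {f : X → Y → Z} (hm : ∀ y, AEMeasurable (fun x => f x y) μ)
    (hc : ∀ x, Continuous (f x)) {g : X → Y} (hg : AEStronglyMeasurable g μ) :
    AEMeasurable (fun x => f x (g x)) μ := by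
  obtain ⟨g', hg', hgg'⟩ := hg
  suffices h : AEMeasurable (fun x => f x (g' x)) μ by
    refine h.congr ?_
    filter_upwards [hgg'] with x hx
    rw [hx]
  refine aemeasurable_of_tendsto_metrizable_ae atTop (f := fun k x => f x (hg'.approx k x))
    (fun k => ?_) (Eventually.of_forall fun x => (hc x).tendsto _ |>.comp (hg'.tendsto_approx x))
  -- On each of the finitely many fibres of the simple function, the second argument of `f` is
  -- frozen.
  have hU : (⋃ y : (hg'.approx k).range, hg'.approx k ⁻¹' {(y : Y)}) = univ := by
    refine eq_univ_of_forall fun x => mem_iUnion.2 ⟨⟨_, (hg'.approx k).mem_range_self x⟩, rfl⟩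
  rw [← Measure.restrict_univ (μ := μ), ← hU, aemeasurable_iUnion_iff]
  intro y
  refine ((hm y).restrict (s := hg'.approx k ⁻¹' {(y : Y)})).congr ?_
  filter_upwards [ae_restrict_mem ((hg'.approx k).measurableSet_fiber y)] with x hx
  rw [show (hg'.approx k) x = y from hx]

end Limits

/-! ### Mollification under a log-Hölder exponent -/

section Mollification

open ContinuousLinearMap

lemma convolution_normed_eq {F : Type*} [NormedAddCommGroup F] [NormedSpace ℝ F]
    (φ : ContDiffBump (0 : Rn n)) (f : Rn n → F) (x : Rn n) :
    (φ.normed volume ⋆[lsmul ℝ ℝ, volume] f) x = ∫ y, φ.normed volume (x - y) • f y := by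
  rw [convolution_eq_swap]; rfl

lemma integrable_normed_sub (φ : ContDiffBump (0 : Rn n)) (x : Rn n) :
    Integrable (fun y => φ.normed volume (x - y)) :=
  φ.integrable_normed.comp_sub_left x

lemma integral_normed_sub (φ : ContDiffBump (0 : Rn n)) (x : Rn n) :
    ∫ y, φ.normed volume (x - y) = 1 := by
  rw [integral_sub_left_eq_self (fun y => φ.normed volume y)]; exact φ.integral_normed

lemma normed_sub_eq_zero (φ : ContDiffBump (0 : Rn n)) {x y : Rn n} (h : φ.rOut ≤ ‖x - y‖) :
    φ.normed volume (x - y) = 0 := by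
  by_contra hne
  have : x - y ∈ Function.support (φ.normed volume) := hne
  rw [φ.support_normed_eq, mem_ball_zero_iff] at this
  linarith

lemma integrable_normed_sub_smul {F : Type*} [NormedAddCommGroup F] [NormedSpace ℝ F]
    (φ : ContDiffBump (0 : Rn n)) {f : Rn n → F} (hf : LocallyIntegrable f) (x : Rn n) :
    Integrable (fun y => φ.normed volume (x - y) • f y) := by
  refine hf.integrable_smul_left_of_hasCompactSupport
    (φ.continuous_normed.comp (continuous_const.sub continuous_id)) ?_
  exact φ.hasCompactSupport_normed.comp_homeomorph (Homeomorph.subLeft x)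

/-- The kernel is bounded by a multiple of `rOut ^ (-n)`. Mollified densities thus grow only
polynomially in `1 / rOut`, so their logarithm is of the order that the log-Hölder modulus cancels.
-/
lemma exists_normed_convolution_add_one_le {F : Rn n → ℝ} (hF : Integrable F)
    (hF0 : ∀ x, 0 ≤ F x) : ∃ B : ℝ, 1 ≤ B ∧ ∀ φ : ContDiffBump (0 : Rn n),
      φ.rOut ≤ 2 * φ.rIn → ∀ x, (φ.normed volume ⋆[lsmul ℝ ℝ, volume] F) x + 1
        ≤ B * (Real.exp 1 + 1 / φ.rOut) ^ n := by
  set v := (volume : Measure (Rn n)).real (closedBall 0 1) with hv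
  have hv0 : 0 < v :=
    ENNReal.toReal_pos (measure_closedBall_pos _ _ one_pos).ne' measure_closedBall_lt_top.ne
  have hI : 0 ≤ ∫ y, F y := integral_nonneg hF0
  refine ⟨2 ^ n / v * (∫ y, F y) + 1, by
    have : 0 ≤ 2 ^ n / v * (∫ y, F y) := by positivity
    linarith, fun φ hφ x => ?_⟩
  have he : 1 < Real.exp 1 := by simp
  have hr := φ.rOut_pos
  have h1 : (1 : ℝ) ≤ (Real.exp 1 + 1 / φ.rOut) ^ n :=
    one_le_pow₀ (by have : 0 < 1 / φ.rOut := by positivity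
                    linarith)
  have h2 : (1 / φ.rOut) ^ n ≤ (Real.exp 1 + 1 / φ.rOut) ^ n := by gcongr; linarith
  have hb : ∀ z, φ.normed volume z ≤ 2 ^ n / v * (1 / φ.rOut) ^ n := fun z => by
    refine (φ.normed_le_div_measure_closedBall_rOut volume 2 hφ z).trans_eq ?_
    rw [Measure.addHaar_real_closedBall' _ _ hr.le, finrank_euclideanSpace_fin]
    rw [← hv, div_pow, one_pow]
    field_simp
  have h3 : (φ.normed volume ⋆[lsmul ℝ ℝ, volume] F) x
      ≤ 2 ^ n / v * (1 / φ.rOut) ^ n * ∫ y, F y := by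
    rw [convolution_normed_eq, ← integral_const_mul]
    refine integral_mono (integrable_normed_sub_smul φ hF.locallyIntegrable x)
      (hF.const_mul _) fun y => ?_
    exact mul_le_mul_of_nonneg_right (hb _) (hF0 y)
  calc _ ≤ 2 ^ n / v * (1 / φ.rOut) ^ n * (∫ y, F y) + 1 := by linarith
    _ ≤ 2 ^ n / v * (Real.exp 1 + 1 / φ.rOut) ^ n * (∫ y, F y)
        + (Real.exp 1 + 1 / φ.rOut) ^ n := by gcongr
    _ = _ := by ring

/-- The key estimate for mollification in variable exponent spaces: for a log-Hölder continuous
exponent, the modular density of a mollified field is controlled by the mollified density. -/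
lemma exists_norm_convolution_rpow_le {p : Rn n → ℝ} {P L : ℝ} (h1 : ∀ x, 1 ≤ p x)
    (hP : ∀ x, p x ≤ P) (hL : 0 ≤ L)
    (hlog : ∀ x y : Rn n, ∀ ε : ℝ, 0 < ε → ‖x - y‖ ≤ ε →
      |1 / p x - 1 / p y| ≤ L / Real.log (Real.exp 1 + 1 / ε))
    {H : Rn n → Rn n} (hH : Integrable H) (hF : Integrable fun y => ‖H y‖ ^ p y) :
    ∃ C : ℝ, 0 ≤ C ∧ ∀ φ : ContDiffBump (0 : Rn n), φ.rOut ≤ 2 * φ.rIn → ∀ x,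
      ‖(φ.normed volume ⋆[lsmul ℝ ℝ, volume] H) x‖ ^ p x
        ≤ C * ((φ.normed volume ⋆[lsmul ℝ ℝ, volume] fun y => ‖H y‖ ^ p y) x + 1) := by
  have hF0 : ∀ y, 0 ≤ ‖H y‖ ^ p y := fun y => by positivity
  obtain ⟨B, hB1, hB⟩ := exists_normed_convolution_add_one_le hF hF0
  set K := Real.exp (P * L * (Real.log B + n)) with hK
  have hK0 : 0 < K := Real.exp_pos _
  have hP0 : 0 ≤ P := by linarith [h1 0, hP 0]
  refine ⟨(1 + K) ^ P, by positivity, fun φ hφ x => ?_⟩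
  set Φ := (φ.normed volume ⋆[lsmul ℝ ℝ, volume] fun y => ‖H y‖ ^ p y) x with hΦ
  have hΦ0 : 0 ≤ Φ := by
    rw [hΦ, convolution_normed_eq]
    exact integral_nonneg fun y => mul_nonneg (φ.nonneg_normed _) (hF0 y)
  have he : 1 < Real.exp 1 := by simp
  have hr := φ.rOut_pos
  set E := Real.exp 1 + 1 / φ.rOut with hE
  have hEe : Real.exp 1 ≤ E := by
    have : 0 < 1 / φ.rOut := by positivity
    linarith
  have hE0 : 0 < E := by linarith
  have hell : 1 ≤ Real.log E := by
    rw [← Real.log_exp 1]; exact Real.log_le_log (by linarith) hEe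
  have hpx : 0 < p x := by linarith [h1 x]
  -- The threshold balancing both terms of `le_add_rpow_mul` after averaging: `l ^ (1 - p x) * Φ ≤
  -- l`.
  set l := (Φ + 1) ^ (1 / p x) with hl
  have hl1 : 1 ≤ l := Real.one_le_rpow (by linarith) (by positivity)
  have hl0 : 0 < l := by linarith
  have hlp : l ^ p x = Φ + 1 := by
    rw [hl, ← Real.rpow_mul (by linarith), one_div_mul_cancel hpx.ne', Real.rpow_one]
  have hlogΦ : Real.log (Φ + 1) ≤ (Real.log B + n) * Real.log E := by
    have := Real.log_le_log (by linarith) (hB φ hφ x)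
    rw [Real.log_mul (by linarith) (by positivity), Real.log_pow] at this
    have hlB := Real.log_nonneg hB1
    nlinarith
  -- Replacing `p y` by `p x` costs only a constant: the power equals `(Φ + 1) ^ (p y * (1 / p y - 1
  -- / p x))`, where `log (Φ + 1)` is at most a multiple of `log E` and the exponent at most a
  -- multiple of `1 / log E`.
  have hexp : ∀ y, ‖x - y‖ ≤ φ.rOut → l ^ (p x - p y) ≤ K := fun y hy => by
    have hpy : 0 < p y := by linarith [h1 y]
    have h2 : p x - p y = p x * (p y * (1 / p y - 1 / p x)) := by field_simp
    have h3 : 1 / p y - 1 / p x ≤ L / Real.log E := by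
      have := hlog x y _ hr hy
      rw [abs_sub_comm] at this
      exact (le_abs_self _).trans this
    have h4 : p y * (1 / p y - 1 / p x) ≤ P * (L / Real.log E) :=
      (mul_le_mul_of_nonneg_left h3 hpy.le).trans
        (mul_le_mul_of_nonneg_right (hP y) (by positivity))
    rw [h2, Real.rpow_mul hl0.le, hlp]
    refine (Real.rpow_le_rpow_of_exponent_le (by linarith) h4).trans ?_
    rw [Real.rpow_def_of_pos (by linarith), hK, Real.exp_le_exp]
    calc Real.log (Φ + 1) * (P * (L / Real.log E))
        ≤ (Real.log B + n) * Real.log E * (P * (L / Real.log E)) := by gcongr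
      _ = _ := by field_simp
  have hpt : ∀ y, φ.normed volume (x - y) * ‖H y‖ ≤ φ.normed volume (x - y) * l +
      K * l ^ (1 - p x) * (φ.normed volume (x - y) * ‖H y‖ ^ p y) := fun y => by
    rcases le_total φ.rOut ‖x - y‖ with h | h
    · simp [normed_sub_eq_zero φ h]
    · have h2 := le_add_rpow_mul (norm_nonneg (H y)) hl0 (h1 y)
      have h3 : l ^ (1 - p y) ≤ K * l ^ (1 - p x) := by
        have : 1 - p y = (p x - p y) + (1 - p x) := by ring
        rw [this, Real.rpow_add hl0]
        exact mul_le_mul_of_nonneg_right (hexp y h) (by positivity)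
      have h4 : ‖H y‖ ≤ l + K * l ^ (1 - p x) * ‖H y‖ ^ p y :=
        h2.trans (add_le_add le_rfl (mul_le_mul_of_nonneg_right h3 (hF0 y)))
      calc _ ≤ φ.normed volume (x - y) * (l + K * l ^ (1 - p x) * ‖H y‖ ^ p y) :=
            mul_le_mul_of_nonneg_left h4 (φ.nonneg_normed _)
        _ = _ := by ring
  have hi1 := (integrable_normed_sub φ x).mul_const l
  have hi2 := (integrable_normed_sub_smul φ hF.locallyIntegrable x).const_mul (K * l ^ (1 - p x))
  have hnorm : ‖(φ.normed volume ⋆[lsmul ℝ ℝ, volume] H) x‖ ≤ (1 + K) * l := by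
    rw [convolution_normed_eq]
    calc ‖∫ y, φ.normed volume (x - y) • H y‖ ≤ ∫ y, φ.normed volume (x - y) * ‖H y‖ := by
          refine (norm_integral_le_integral_norm _).trans_eq ?_
          simp only [norm_smul, Real.norm_of_nonneg (φ.nonneg_normed _)]
      _ ≤ ∫ y, (φ.normed volume (x - y) * l +
            K * l ^ (1 - p x) * (φ.normed volume (x - y) * ‖H y‖ ^ p y)) :=
          integral_mono (integrable_normed_sub_smul φ hH.norm.locallyIntegrable x)
            (hi1.add hi2) hpt
      _ = l + K * l ^ (1 - p x) * Φ := by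
          rw [integral_add hi1 (by exact hi2), integral_mul_const, integral_normed_sub, one_mul,
            integral_const_mul, hΦ, convolution_normed_eq]
          rfl
      _ ≤ l + K * l ^ (1 - p x) * l ^ p x := by
          rw [hlp]; gcongr; linarith
      _ = (1 + K) * l := by
          rw [mul_assoc, ← Real.rpow_add hl0]; simp; ring
  calc _ ≤ ((1 + K) * l) ^ p x := by gcongr
    _ = (1 + K) ^ p x * (Φ + 1) := by rw [Real.mul_rpow (by positivity) hl0.le, hlp]
    _ ≤ (1 + K) ^ P * (Φ + 1) := by
      gcongr
      · linarith
      · exact hP x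

/-- The standard sequence of bump functions. -/
noncomputable def stdBump (n : ℕ) (k : ℕ) : ContDiffBump (0 : Rn n) where
  rIn := 1 / (2 * (k + 1))
  rOut := 1 / (k + 1)
  rIn_pos := by positivity
  rIn_lt_rOut := by
    apply one_div_lt_one_div_of_lt <;> linarith [(k.cast_nonneg : (0 : ℝ) ≤ k)]

lemma stdBump_rOut (k : ℕ) : (stdBump n k).rOut = 1 / (k + 1) := rfl

lemma stdBump_rOut_le_one (k : ℕ) : (stdBump n k).rOut ≤ 1 := by
  rw [stdBump_rOut, div_le_one (by positivity)]
  linarith [(k.cast_nonneg : (0 : ℝ) ≤ k)]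

lemma stdBump_rOut_le (k : ℕ) : (stdBump n k).rOut ≤ 2 * (stdBump n k).rIn := by
  change 1 / ((k : ℝ) + 1) ≤ 2 * (1 / (2 * (k + 1)))
  apply le_of_eq; field_simp

lemma tendsto_stdBump_rOut : Tendsto (fun k => (stdBump n k).rOut) atTop (𝓝 0) :=
  tendsto_one_div_add_atTop_nhds_zero_nat

/-- Mollification at scale `1 / (k + 1)`. -/
noncomputable def mollify {F : Type*} [NormedAddCommGroup F] [NormedSpace ℝ F] (k : ℕ)
    (f : Rn n → F) : Rn n → F :=
  (stdBump n k).normed volume ⋆[lsmul ℝ ℝ, volume] f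

variable {F : Type*} [NormedAddCommGroup F] [NormedSpace ℝ F]

lemma mollify_eq (k : ℕ) (f : Rn n → F) (x : Rn n) :
    mollify k f x = ∫ y, (stdBump n k).normed volume (x - y) • f y :=
  convolution_normed_eq _ _ _

/-- All kernels have radius at most 1. This permits truncating a locally integrable field without
changing its mollifications well inside. -/
lemma mollify_congr {f g : Rn n → F} {x : Rn n} (h : ∀ y, ‖x - y‖ < 1 → f y = g y) (k : ℕ) :
    mollify k f x = mollify k g x := by
  rw [mollify_eq, mollify_eq]
  congr 1; ext y
  rcases lt_or_ge ‖x - y‖ 1 with h1 | h1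
  · rw [h y h1]
  · simp [normed_sub_eq_zero (stdBump n k) ((stdBump_rOut_le_one k).trans h1)]

lemma abs_mollify_le {f : Rn n → ℝ} {M : ℝ} (hM : ∀ x, |f x| ≤ M) (k : ℕ) (x : Rn n) :
    |mollify k f x| ≤ M := by
  rw [mollify_eq, ← Real.norm_eq_abs]
  have := norm_integral_le_of_norm_le ((integrable_normed_sub (stdBump n k) x).mul_const M)
    (f := fun y => (stdBump n k).normed volume (x - y) • f y) (Eventually.of_forall fun y => by
      rw [norm_smul, Real.norm_of_nonneg ((stdBump n k).nonneg_normed _)]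
      exact mul_le_mul_of_nonneg_left (hM y) ((stdBump n k).nonneg_normed _))
  rwa [integral_mul_const, integral_normed_sub, one_mul] at this

lemma contDiff_mollify (k : ℕ) {f : Rn n → F} (hf : LocallyIntegrable f) :
    ContDiff ℝ ∞ (mollify k f) :=
  (stdBump n k).hasCompactSupport_normed.contDiff_convolution_left _
    (stdBump n k).contDiff_normed hf

lemma tendsto_mollify [CompleteSpace F] {f : Rn n → F} (hf : Continuous f) (x : Rn n) :
    Tendsto (fun k => mollify k f x) atTop (𝓝 (f x)) :=
  ContDiffBump.convolution_tendsto_right_of_continuous tendsto_stdBump_rOut hf x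

lemma ae_tendsto_mollify [CompleteSpace F] {f : Rn n → F} (hf : LocallyIntegrable f) :
    ∀ᵐ x, Tendsto (fun k => mollify k f x) atTop (𝓝 (f x)) :=
  ContDiffBump.ae_convolution_tendsto_right_of_locallyIntegrable tendsto_stdBump_rOut
    (Eventually.of_forall stdBump_rOut_le) hf

lemma integrable_mollify (k : ℕ) {f : Rn n → F} (hf : Integrable f) : Integrable (mollify k f) :=
  (stdBump n k).integrable_normed.integrable_convolution _ hf

lemma integral_mollify (k : ℕ) {f : Rn n → ℝ} (hf : Integrable f) :
    ∫ x, mollify k f x = ∫ x, f x := by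
  unfold mollify
  rw [integral_convolution _ (stdBump n k).integrable_normed hf, (stdBump n k).integral_normed]
  simp

/-- Mollification preserves both nonnegativity and the integral, so a.e. convergence suffices by
Scheffé's lemma. -/
lemma tendsto_integral_abs_mollify_sub {f : Rn n → ℝ} (hf : Integrable f) (h0 : ∀ x, 0 ≤ f x) :
    Tendsto (fun k => ∫ x, |mollify k f x - f x|) atTop (𝓝 0) := by
  refine tendsto_integral_abs_sub_of_ae hf (fun k => integrable_mollify k hf) (fun k x => ?_)
    (ae_tendsto_mollify hf.locallyIntegrable) ?_
  · rw [mollify_eq]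
    exact integral_nonneg fun y => mul_nonneg ((stdBump n k).nonneg_normed _) (h0 y)
  · simp_rw [integral_mollify _ hf]
    exact tendsto_const_nhds

/-- The gradient of a mollified function is the mollified weak gradient. -/
lemma gradient_mollify {u : Rn n → ℝ} {G : Rn n → Rn n} (h : IsWeakGradient univ u G)
    (k : ℕ) (x : Rn n) : gradient (mollify k u) x = mollify k G x := by
  have hu : LocallyIntegrable u := locallyIntegrableOn_univ.1 h.locallyIntegrableOn
  have hG : LocallyIntegrable G := locallyIntegrableOn_univ.1 h.locallyIntegrableOn_grad
  set ρ := (stdBump n k).normed volume with hρ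
  have hρc : ContDiff ℝ ∞ ρ := (stdBump n k).contDiff_normed
  have hρs : HasCompactSupport ρ := (stdBump n k).hasCompactSupport_normed
  have hd := hρs.hasFDerivAt_convolution_left (lsmul ℝ ℝ) (hρc.of_le (by simp)) hu x
  -- The reflected kernel is the test function; the sign from differentiating `x - y` cancels the
  -- one in the definition of the weak gradient.
  have htest : IsTestFunction univ (fun y => ρ (x - y)) :=
    ⟨hρc.comp (contDiff_const.sub contDiff_id), hρs.comp_homeomorph (Homeomorph.subLeft x),
      subset_univ _⟩
  have hw := h.integral_eq _ htest
  simp only [Measure.restrict_univ] at hw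
  have hgrad : ∀ y, gradient (fun y => ρ (x - y)) y = - gradient ρ (x - y) := fun y => by
    have h1 : HasFDerivAt ρ (fderiv ℝ ρ (x - y)) (x - y) :=
      ((hρc.differentiable (by simp)) _).hasFDerivAt
    have h2 := h1.comp y ((hasFDerivAt_id y).const_sub x)
    have h3 : fderiv ℝ (fun y => ρ (x - y)) y = - fderiv ℝ ρ (x - y) := by
      have := h2.fderiv
      simp only [Function.comp_def] at this
      rw [this]; ext z; simp
    rw [gradient, gradient, h3, map_neg]
  simp_rw [hgrad] at hw
  have hcs : HasCompactSupport (fderiv ℝ ρ) := hρs.fderiv ℝ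
  have hcc : Continuous (fderiv ℝ ρ) := hρc.continuous_fderiv (by simp)
  have hex := (hcs.convolutionExists_left ((lsmul ℝ ℝ).precompL (Rn n)) hcc hu) x
  have hint : ∫ y, u y • gradient ρ (x - y) = mollify k G x := by
    rw [mollify_eq, ← neg_inj, ← hw, ← integral_neg]
    simp
  have hgc : Continuous (gradient ρ) :=
    (InnerProductSpace.toDual ℝ (Rn n)).symm.continuous.comp hcc
  have hgs : HasCompactSupport (gradient ρ) :=
    hcs.comp_left (map_zero (InnerProductSpace.toDual ℝ (Rn n)).symm)
  have hi : Integrable (fun y => u y • gradient ρ (x - y)) :=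
    hu.integrable_smul_right_of_hasCompactSupport
      (hgc.comp (continuous_const.sub continuous_id))
      (hgs.comp_homeomorph (Homeomorph.subLeft x))
  rw [← hint, gradient, mollify, hd.fderiv, LinearIsometryEquiv.symm_apply_eq]
  ext z
  rw [InnerProductSpace.toDual_apply_apply, real_inner_comm, ← integral_inner hi,
    convolution_eq_swap, ContinuousLinearMap.integral_apply hex.integrable_swap]
  congr 1; ext y
  rw [real_inner_comm, real_inner_smul_left, gradient, InnerProductSpace.toDual_symm_apply,
    ContinuousLinearMap.precompL_apply, lsmul_apply, smul_eq_mul, mul_comm]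

end Mollification

/-! ### Calculus of gradients -/

section Gradient

lemma gradient_mul {f g : Rn n → ℝ} {x : Rn n} (hf : DifferentiableAt ℝ f x)
    (hg : DifferentiableAt ℝ g x) :
    gradient (fun y => f y * g y) x = f x • gradient g x + g x • gradient f x := by
  simp only [gradient]
  rw [fderiv_fun_mul hf hg, map_add]; simp

lemma gradient_pow {f : Rn n → ℝ} {x : Rn n} (hf : DifferentiableAt ℝ f x) (q : ℕ) :
    gradient (fun y => f y ^ q) x = (q * f x ^ (q - 1)) • gradient f x := by
  simp only [gradient]
  rw [fderiv_fun_pow _ hf]; simp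

lemma IsTestFunction.continuous_gradient {Ω : Set (Rn n)} {η : Rn n → ℝ}
    (h : IsTestFunction Ω η) : Continuous (gradient η) :=
  (InnerProductSpace.toDual ℝ (Rn n)).symm.continuous.comp
    (h.contDiff.continuous_fderiv (by simp))

lemma IsTestFunction.hasCompactSupport_gradient {Ω : Set (Rn n)} {η : Rn n → ℝ}
    (h : IsTestFunction Ω η) : HasCompactSupport (gradient η) :=
  (h.hasCompactSupport.fderiv ℝ).comp_left (map_zero (InnerProductSpace.toDual ℝ (Rn n)).symm)

lemma gradient_eq_zero_of_notMem_tsupport {η : Rn n → ℝ} {x : Rn n} (hx : x ∉ tsupport η) :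
    gradient η x = 0 := by
  have : fderiv ℝ η x = 0 := image_eq_zero_of_notMem_tsupport
    fun h => hx (tsupport_fderiv_subset ℝ h)
  rw [gradient, this, map_zero]

end Gradient

/-! ### Local integrability of the modular density -/

section LocalIntegrability

/-- For a bounded exponent, the scaling `m` in the definition of `L^{p(·)}` comes out of the modular
as a factor at most `max 1 m ^ P`. -/
lemma MemLpVarLoc.locallyIntegrable_rpow {p : Rn n → ℝ} {P : ℝ} (hpc : Continuous p)
    (h1 : ∀ x, 1 ≤ p x) (hP : ∀ x, p x ≤ P) {G : Rn n → Rn n} (hG : MemLpVarLoc univ p G) :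
    LocallyIntegrable (fun x => ‖G x‖ ^ p x) := by
  intro x
  refine ⟨ball x 1, ball_mem_nhds x one_pos, ?_⟩
  obtain ⟨hm, m, hm0, hfin⟩ := hG (ball x 1) isOpen_ball
    (isCompact_closedBall x 1 |>.of_isClosed_subset isClosed_closure closure_ball_subset_closedBall)
    (subset_univ _)
  have hmeas : ∀ c : ℝ, AEStronglyMeasurable (fun y => ‖c • G y‖ ^ p y)
      (volume.restrict (ball x 1)) := fun c =>
    ((hm.const_smul c).norm.aemeasurable.pow hpc.measurable.aemeasurable).aestronglyMeasurable
  have hi : IntegrableOn (fun y => ‖m⁻¹ • G y‖ ^ p y) (ball x 1) := by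
    refine ⟨hmeas _, ?_⟩
    rw [hasFiniteIntegral_iff_ofReal (Eventually.of_forall fun y => by positivity)]
    exact hfin
  refine (hi.const_mul (max 1 m ^ P)).mono' (by simpa using hmeas 1)
    (Eventually.of_forall fun y => ?_)
  have hp0 : 0 ≤ p y := by linarith [h1 y]
  rw [Real.norm_of_nonneg (by positivity), norm_smul, Real.norm_of_nonneg (inv_pos.2 hm0).le,
    Real.mul_rpow (by positivity) (norm_nonneg _), ← mul_assoc]
  refine le_mul_of_one_le_left (by positivity) ?_
  have h2 : m ^ p y ≤ max 1 m ^ P :=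
    (Real.rpow_le_rpow hm0.le (le_max_right _ _) hp0).trans
      (Real.rpow_le_rpow_of_exponent_le (le_max_left _ _) (hP y))
  calc (1 : ℝ) = m ^ p y * m⁻¹ ^ p y := by
        rw [← Real.mul_rpow hm0.le (by positivity), mul_inv_cancel₀ hm0.ne', Real.one_rpow]
    _ ≤ _ := by gcongr

end LocalIntegrability

/-! ### Testing the equation with the solution; the Caccioppoli inequality -/

section Caccioppoli

variable {p : Rn n → ℝ} {P b M : ℝ} {u : Rn n → ℝ} {G V : Rn n → Rn n}

lemma integrable_cutoff_mul_rpow (hF : LocallyIntegrable fun x => ‖G x‖ ^ p x) {η : Rn n → ℝ}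
    (hη : IsTestFunction univ η) : Integrable fun x => η x * ‖G x‖ ^ p x :=
  hF.integrable_smul_left_of_hasCompactSupport hη.contDiff.continuous hη.hasCompactSupport

/-- A bounded weak solution times a cut-off function is an admissible test function. -/
lemma integral_cutoff_eq (h1 : ∀ x, 1 ≤ p x)
    (hP : ∀ x, p x ≤ P) (hlog : LogHolderOn univ fun x => 1 / p x)
    (hu : Continuous u) (hM : ∀ x, |u x| ≤ M) (hw : IsWeakGradient univ u G)
    (hF : LocallyIntegrable fun x => ‖G x‖ ^ p x) (hb : 0 ≤ b)
    (hVm : AEStronglyMeasurable V) (hV : ∀ x, ‖V x‖ ≤ b * ‖G x‖ ^ (p x - 1))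
    (heq : ∀ φ : Rn n → ℝ, IsTestFunction univ φ → ∫ x, inner ℝ (V x) (gradient φ x) = 0)
    {η : Rn n → ℝ} (hη : IsTestFunction univ η) :
    ∫ x, η x * inner ℝ (V x) (G x) = - ∫ x, u x * inner ℝ (V x) (gradient η x) := by
  have hul : LocallyIntegrable u := hu.locallyIntegrable
  have hGl : LocallyIntegrable G := locallyIntegrableOn_univ.1 hw.locallyIntegrableOn_grad
  obtain ⟨L, hL, hlog⟩ := hlog.exists_le
  obtain ⟨r, hr⟩ := hη.hasCompactSupport.isCompact.isBounded.subset_closedBall 0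
  obtain ⟨E, hE⟩ := hη.hasCompactSupport.exists_bound_of_continuous hη.contDiff.continuous
  obtain ⟨D, hD⟩ :=
    hη.hasCompactSupport_gradient.exists_bound_of_continuous hη.continuous_gradient
  have hE0 : 0 ≤ E := (norm_nonneg _).trans (hE 0)
  have hD0 : 0 ≤ D := (norm_nonneg _).trans (hD 0)
  have hM0 : 0 ≤ M := (abs_nonneg _).trans (hM 0)
  -- The margin 1 matches the maximal kernel radius, so `G` and its truncation `H` have the same
  -- mollifications on the support of `η`.
  set B : Set (Rn n) := closedBall 0 (r + 1) with hB
  have hBm : MeasurableSet B := measurableSet_closedBall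
  have hBc : IsCompact B := isCompact_closedBall _ _
  set H : Rn n → Rn n := B.indicator G with hH
  set F : Rn n → ℝ := fun x => ‖H x‖ ^ p x with hFdef
  set χ : Rn n → ℝ := B.indicator 1 with hχ
  have hFB : F = B.indicator fun x => ‖G x‖ ^ p x := by
    ext x
    by_cases hx : x ∈ B
    · simp [hFdef, hH, hx]
    · simp [hFdef, hH, hx, Real.zero_rpow (by linarith [h1 x] : p x ≠ 0)]
  have hHi : Integrable H := (hGl.integrableOn_isCompact hBc).integrable_indicator hBm
  have hFi : Integrable F := hFB ▸ (hF.integrableOn_isCompact hBc).integrable_indicator hBm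
  have hχi : Integrable χ :=
    (integrableOn_const (C := (1 : ℝ)) hBc.measure_lt_top.ne).integrable_indicator hBm
  have hF0 : ∀ x, 0 ≤ F x := fun x => by positivity
  obtain ⟨C, hC0, hC⟩ := exists_norm_convolution_rpow_le h1 hP hL hlog hHi hFi
  have hsupp : ∀ x, x ∈ tsupport η → ‖x‖ ≤ r := fun x hx => by simpa using hr hx
  have hη0 : ∀ x, ¬ ‖x‖ ≤ r → η x = 0 := fun x hx =>
    image_eq_zero_of_notMem_tsupport fun h => hx (hsupp x h)
  have hgη0 : ∀ x, ¬ ‖x‖ ≤ r → gradient η x = 0 := fun x hx =>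
    gradient_eq_zero_of_notMem_tsupport fun h => hx (hsupp x h)
  have hin : ∀ x, ‖x‖ ≤ r → x ∈ B := fun x hx => by
    rw [hB, mem_closedBall_zero_iff]; linarith
  have hmG : ∀ k x, ‖x‖ ≤ r → mollify k G x = mollify k H x := fun k x hx => by
    refine mollify_congr (fun y hy => ?_) k
    have : y ∈ B := by
      rw [hB, mem_closedBall_zero_iff]
      have := norm_sub_norm_le y x
      rw [norm_sub_rev] at this
      linarith
    simp [hH, this]
  have hFk0 : ∀ k x, 0 ≤ mollify k F x := fun k x => by
    rw [mollify_eq]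
    exact integral_nonneg fun y => mul_nonneg ((stdBump n k).nonneg_normed _) (hF0 y)
  have hχ0 : ∀ x, 0 ≤ χ x := indicator_nonneg (by simp)
  have hχ1 : ∀ x, ‖x‖ ≤ r → χ x = 1 := fun x hx => by simp [hχ, hin x hx]
  have hFG : ∀ x, ‖x‖ ≤ r → ‖G x‖ ^ p x = F x := fun x hx => by
    simp [hFdef, hH, hin x hx]
  -- These majorants vary with `k` but converge in `L¹`. The indicator `χ` stands for the constant 1
  -- of the modular estimate and keeps them integrable.
  set gk : ℕ → Rn n → ℝ := fun k x => E * b * (F x + C * (mollify k F x + χ x)) with hgk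
  set g : Rn n → ℝ := fun x => E * b * (F x + C * (F x + χ x)) with hg
  have hgi : Integrable g := (hFi.add ((hFi.add hχi).const_mul C)).const_mul _
  have hgki : ∀ k, Integrable (gk k) := fun k =>
    (hFi.add (((integrable_mollify k hFi).add hχi).const_mul C)).const_mul _
  have hηm : AEStronglyMeasurable η := hη.contDiff.continuous.aestronglyMeasurable
  have hwkm : ∀ k, AEStronglyMeasurable (mollify k G) := fun k =>
    (contDiff_mollify k hGl).continuous.aestronglyMeasurable
  have hm1 : ∀ k, AEStronglyMeasurable fun x => η x * inner ℝ (V x) (mollify k G x) := fun k =>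
    hηm.mul (hVm.inner (hwkm k))
  have hle1 : ∀ k x, |η x * inner ℝ (V x) (mollify k G x)| ≤ gk k x := fun k x => by
    by_cases hx : ‖x‖ ≤ r
    · have hn := hC (stdBump n k) (stdBump_rOut_le k) x
      change ‖mollify k H x‖ ^ p x ≤ C * (mollify k F x + 1) at hn
      have h2 := rpow_sub_one_mul_le (norm_nonneg (G x)) (norm_nonneg (mollify k G x)) (h1 x)
      rw [abs_mul]
      simp only [hgk]
      rw [mul_assoc E]
      refine mul_le_mul (hE x) ?_ (abs_nonneg _) hE0
      calc |inner ℝ (V x) (mollify k G x)| ≤ ‖V x‖ * ‖mollify k G x‖ := abs_real_inner_le_norm _ _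
        _ ≤ b * ‖G x‖ ^ (p x - 1) * ‖mollify k G x‖ := by gcongr; exact hV x
        _ = b * (‖G x‖ ^ (p x - 1) * ‖mollify k G x‖) := by ring
        _ ≤ b * (F x + C * (mollify k F x + χ x)) := by
          gcongr
          refine h2.trans ?_
          rw [hmG k x hx, hFG x hx, hχ1 x hx]
          linarith
    · rw [hη0 x hx]
      have := hFk0 k x
      have := hχ0 x
      have := hF0 x
      simp only [zero_mul, abs_zero, hgk]
      positivity
  have hi1 : ∀ k, Integrable fun x => η x * inner ℝ (V x) (mollify k G x) := fun k =>
    (hgki k).mono' (hm1 k) (Eventually.of_forall (hle1 k))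
  have hlim1 : Tendsto (fun k => ∫ x, η x * inner ℝ (V x) (mollify k G x)) atTop
      (𝓝 (∫ x, η x * inner ℝ (V x) (G x))) := by
    refine tendsto_integral_of_dominated_of_tendsto_integral_abs hm1 hgi hgki
      (fun k => Eventually.of_forall (hle1 k)) ?_ ?_ ?_
    · filter_upwards [ae_tendsto_mollify hGl] with x hx
      exact (tendsto_const_nhds.inner hx).const_mul _
    · filter_upwards [ae_tendsto_mollify hFi.locallyIntegrable] with x hx
      exact (((hx.add_const (χ x)).const_mul C).const_add (F x)).const_mul _
    · have h2 : ∀ k x, |gk k x - g x| = E * b * C * |mollify k F x - F x| := fun k x => by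
        have : gk k x - g x = E * b * C * (mollify k F x - F x) := by simp only [hgk, hg]; ring
        rw [this, abs_mul, abs_of_nonneg (by positivity)]
      simp_rw [h2, integral_const_mul]
      simpa using (tendsto_integral_abs_mollify_sub hFi hF0).const_mul (E * b * C)
  have hVle : ∀ x, ‖x‖ ≤ r → ‖V x‖ ≤ b * (F x + χ x) := fun x hx => by
    have h2 := rpow_sub_one_mul_le (norm_nonneg (G x)) zero_le_one (h1 x)
    rw [hFG x hx, Real.one_rpow, mul_one] at h2
    rw [hχ1 x hx]
    exact (hV x).trans (mul_le_mul_of_nonneg_left h2 hb)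
  have hm2 : ∀ k, AEStronglyMeasurable fun x => mollify k u x * inner ℝ (V x) (gradient η x) :=
    fun k => (contDiff_mollify k hul).continuous.aestronglyMeasurable.mul
      (hVm.inner hη.continuous_gradient.aestronglyMeasurable)
  have hle2 : ∀ k x, |mollify k u x * inner ℝ (V x) (gradient η x)|
      ≤ M * (b * (F x + χ x) * D) := fun k x => by
    have := hχ0 x
    have := hF0 x
    rw [abs_mul]
    refine mul_le_mul (abs_mollify_le hM k x) ?_ (abs_nonneg _) hM0
    by_cases hx : ‖x‖ ≤ r
    · exact (abs_real_inner_le_norm _ _).trans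
        (mul_le_mul (hVle x hx) (hD x) (norm_nonneg _) (by positivity))
    · rw [hgη0 x hx, inner_zero_right, abs_zero]; positivity
  have hdom2 : Integrable fun x => M * (b * (F x + χ x) * D) :=
    (((hFi.add hχi).const_mul b).mul_const D).const_mul M
  have hi2 : ∀ k, Integrable fun x => mollify k u x * inner ℝ (V x) (gradient η x) := fun k =>
    hdom2.mono' (hm2 k) (Eventually.of_forall (hle2 k))
  have hlim2 : Tendsto (fun k => ∫ x, mollify k u x * inner ℝ (V x) (gradient η x)) atTop
      (𝓝 (∫ x, u x * inner ℝ (V x) (gradient η x))) :=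
    tendsto_integral_of_dominated_convergence _ hm2 hdom2
      (fun k => Eventually.of_forall (hle2 k))
      (Eventually.of_forall fun x => (tendsto_mollify hu x).mul_const _)
  -- This is the equation tested with the smooth function `η * mollify k u`.
  have hzero : ∀ k, (∫ x, η x * inner ℝ (V x) (mollify k G x)) +
      (∫ x, mollify k u x * inner ℝ (V x) (gradient η x)) = 0 := fun k => by
    have hus := contDiff_mollify k hul
    have ht : IsTestFunction univ fun x => η x * mollify k u x :=
      ⟨hη.contDiff.mul hus, hη.hasCompactSupport.mul_right, subset_univ _⟩
    rw [← integral_add (hi1 k) (hi2 k), ← heq _ ht]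
    congr 1; ext x
    rw [gradient_mul ((hη.contDiff.differentiable (by simp)) x)
      ((hus.differentiable (by simp)) x), gradient_mollify hw, inner_add_right,
      real_inner_smul_right, real_inner_smul_right]
  have hlim := hlim1.add hlim2
  simp_rw [hzero] at hlim
  have := tendsto_nhds_unique hlim tendsto_const_nhds
  linarith

/-- The Caccioppoli inequality for bounded solutions. -/
lemma exists_caccioppoli (hpc : Continuous p) (h1 : ∀ x, 1 ≤ p x)
    (hP : ∀ x, p x ≤ P) (hlog : LogHolderOn univ fun x => 1 / p x)
    (hu : Continuous u) (hM : ∀ x, |u x| ≤ M) (hw : IsWeakGradient univ u G)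
    (hF : LocallyIntegrable fun x => ‖G x‖ ^ p x) {a : ℝ} (ha : 0 < a) (hb : 0 ≤ b)
    (hVm : AEStronglyMeasurable V) (hV : ∀ x, ‖V x‖ ≤ b * ‖G x‖ ^ (p x - 1))
    (hVG : ∀ x, a * ‖G x‖ ^ p x ≤ inner ℝ (V x) (G x))
    (heq : ∀ φ : Rn n → ℝ, IsTestFunction univ φ → ∫ x, inner ℝ (V x) (gradient φ x) = 0) :
    ∃ (q : ℕ) (C : ℝ), 0 ≤ C ∧ ∀ ζ : Rn n → ℝ, IsTestFunction univ ζ → (∀ x, 0 ≤ ζ x) →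
      (∀ x, ζ x ≤ 1) → Integrable (fun x => ζ x ^ q * ‖G x‖ ^ p x) ∧
        ∫ x, ζ x ^ q * ‖G x‖ ^ p x ≤ C * ∫ x, ‖gradient ζ x‖ ^ p x := by
  obtain ⟨q, hq⟩ := exists_nat_ge P
  have hq0 : q ≠ 0 := by
    rintro rfl
    have := h1 0; have := hP 0
    norm_num at hq
    linarith
  have hM0 : 0 ≤ M := (abs_nonneg _).trans (hM 0)
  set N := M * (b * q) with hN
  have hN0 : 0 ≤ N := by positivity
  -- Makes the gradient term from Young's inequality at most half of the coercive term, so that it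
  -- can be absorbed; the integral absorbed is finite by `hi`.
  set τ := min 1 (a / (2 * (N + 1))) with hτ
  have hτ0 : 0 < τ := lt_min one_pos (by positivity)
  have hτ1 : τ ≤ 1 := min_le_left _ _
  have hNτ : N * τ ≤ a / 2 := by
    have h2 : τ ≤ a / (2 * (N + 1)) := min_le_right _ _
    rw [le_div_iff₀ (by positivity)] at h2
    nlinarith
  refine ⟨q, 2 / a * (N * τ ^ (-P)), by positivity, fun ζ hζ hζ0 hζ1 => ?_⟩
  have hη : IsTestFunction univ fun x => ζ x ^ q :=
    ⟨hζ.contDiff.pow q, hζ.hasCompactSupport.comp_left (g := fun t => t ^ q) (zero_pow hq0),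
      subset_univ _⟩
  have hi := integrable_cutoff_mul_rpow hF hη
  have hgi : Integrable fun x => ‖gradient ζ x‖ ^ p x := by
    refine Continuous.integrable_of_hasCompactSupport
      (hζ.continuous_gradient.norm.rpow hpc fun x => Or.inr (by linarith [h1 x])) ?_
    refine hζ.hasCompactSupport_gradient.mono fun x hx => ?_
    contrapose! hx
    rw [Function.notMem_support] at hx ⊢
    rw [hx, norm_zero, Real.zero_rpow (by linarith [h1 x])]
  have hGm : AEStronglyMeasurable G :=
    (locallyIntegrableOn_univ.1 hw.locallyIntegrableOn_grad).aestronglyMeasurable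
  have hiV : Integrable fun x => ζ x ^ q * inner ℝ (V x) (G x) := by
    refine (hi.const_mul b).mono' (hη.contDiff.continuous.aestronglyMeasurable.mul
      (hVm.inner hGm)) (Eventually.of_forall fun x => ?_)
    have hkey : ‖G x‖ ^ (p x - 1) * ‖G x‖ = ‖G x‖ ^ p x := by
      rw [← Real.rpow_add_one' (norm_nonneg _) (by linarith [h1 x])]; simp
    have hz := hζ0 x
    rw [norm_mul, Real.norm_of_nonneg (by positivity), Real.norm_eq_abs]
    calc _ ≤ ζ x ^ q * (‖V x‖ * ‖G x‖) := by gcongr; exact abs_real_inner_le_norm _ _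
      _ ≤ ζ x ^ q * (b * ‖G x‖ ^ (p x - 1) * ‖G x‖) := by gcongr; exact hV x
      _ = _ := by rw [mul_assoc b, hkey]; ring
  refine ⟨hi, ?_⟩
  have hid := integral_cutoff_eq h1 hP hlog hu hM hw hF hb hVm hV heq hη
  have hlow : a * ∫ x, ζ x ^ q * ‖G x‖ ^ p x ≤ ∫ x, ζ x ^ q * inner ℝ (V x) (G x) := by
    rw [← integral_const_mul]
    refine integral_mono (hi.const_mul a) hiV fun x => ?_
    have hz := hζ0 x
    calc a * (ζ x ^ q * ‖G x‖ ^ p x) = ζ x ^ q * (a * ‖G x‖ ^ p x) := by ring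
      _ ≤ _ := by gcongr; exact hVG x
  have hup : - ∫ x, u x * inner ℝ (V x) (gradient (fun y => ζ y ^ q) x)
      ≤ a / 2 * (∫ x, ζ x ^ q * ‖G x‖ ^ p x) + N * τ ^ (-P) * ∫ x, ‖gradient ζ x‖ ^ p x := by
    rw [← integral_const_mul, ← integral_const_mul,
      ← integral_add (hi.const_mul _) (hgi.const_mul _)]
    refine (neg_le_abs _).trans ?_
    rw [← Real.norm_eq_abs]
    refine norm_integral_le_of_norm_le (by exact (hi.const_mul _).add (hgi.const_mul _))
      (Eventually.of_forall fun x => ?_)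
    have hz := hζ0 x
    have hy := pow_mul_rpow_mul_le (hζ0 x) (hζ1 x) (norm_nonneg (G x))
      (norm_nonneg (gradient ζ x)) hτ0 hτ1 (h1 x) (hP x) hq
    have hGp : 0 ≤ ζ x ^ q * ‖G x‖ ^ p x := by positivity
    rw [gradient_pow ((hζ.contDiff.differentiable (by simp)) x), real_inner_smul_right,
      Real.norm_eq_abs, abs_mul, abs_mul, abs_of_nonneg (by positivity : 0 ≤ q * ζ x ^ (q - 1))]
    calc _ ≤ M * (q * ζ x ^ (q - 1) * (b * ‖G x‖ ^ (p x - 1) * ‖gradient ζ x‖)) := by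
          gcongr
          · exact hM x
          · refine (abs_real_inner_le_norm _ _).trans ?_
            gcongr
            exact hV x
      _ = N * (ζ x ^ (q - 1) * ‖G x‖ ^ (p x - 1) * ‖gradient ζ x‖) := by rw [hN]; ring
      _ ≤ N * (τ * (ζ x ^ q * ‖G x‖ ^ p x) + τ ^ (-P) * ‖gradient ζ x‖ ^ p x) := by gcongr
      _ = N * τ * (ζ x ^ q * ‖G x‖ ^ p x) + N * τ ^ (-P) * ‖gradient ζ x‖ ^ p x := by ring
      _ ≤ _ := by
        gcongr
  rw [hid] at hlow
  have hfin := hlow.trans hup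
  rw [div_mul_eq_mul_div, div_mul_eq_mul_div, le_div_iff₀ ha]
  linarith

end Caccioppoli

/-! ### Cut-off functions on annuli and their modular decay -/

section Cutoff

/-- A smooth function on `ℝⁿ` with values in `[0, 1]`, equal to `1` on the unit ball and vanishing
outside the ball of radius `2`. -/
noncomputable def unitBump (n : ℕ) : ContDiffBump (0 : Rn n) where
  rIn := 1
  rOut := 2
  rIn_pos := one_pos
  rIn_lt_rOut := one_lt_two

lemma gradient_unitBump_eq_zero {z : Rn n} (hz : ‖z‖ < 1 ∨ 2 ≤ ‖z‖) :
    gradient (unitBump n) z = 0 := by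
  suffices h : fderiv ℝ (unitBump n) z = 0 by rw [gradient, h, map_zero]
  rcases hz with hz | hz
  · have : (unitBump n : Rn n → ℝ) =ᶠ[𝓝 z] fun _ => 1 := by
      filter_upwards [isOpen_ball.mem_nhds (mem_ball_zero_iff.2 hz)] with y hy
      exact (unitBump n).one_of_mem_closedBall (ball_subset_closedBall hy)
    rw [this.fderiv_eq]; simp
  -- The bump attains its minimum 0 at such points, which also covers the sphere `‖z‖ = 2`, where it
  -- is not locally constant.
  · refine IsLocalMin.fderiv_eq_zero (Eventually.of_forall fun y => ?_)
    rw [(unitBump n).zero_of_le_dist (by rw [dist_zero_right]; exact hz)]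
    exact (unitBump n).nonneg

/-- The cut-off function between the balls of radius `R` and `2 * R` around `x₀`. -/
noncomputable def cutoff (x₀ : Rn n) (R : ℝ) (x : Rn n) : ℝ := unitBump n (R⁻¹ • (x - x₀))

variable {x₀ : Rn n} {R : ℝ}

lemma norm_inv_smul_sub (hR : 0 < R) (x : Rn n) : ‖R⁻¹ • (x - x₀)‖ = dist x x₀ / R := by
  rw [norm_smul, Real.norm_of_nonneg (inv_pos.2 hR).le, dist_eq_norm]; ring

lemma isTestFunction_cutoff (hR : 0 < R) : IsTestFunction univ (cutoff x₀ R) := by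
  refine ⟨(unitBump n).contDiff.comp ((contDiff_id.sub contDiff_const).const_smul R⁻¹), ?_,
    subset_univ _⟩
  refine HasCompactSupport.intro (isCompact_closedBall x₀ (2 * R)) fun x hx => ?_
  refine (unitBump n).zero_of_le_dist ?_
  rw [dist_zero_right, norm_inv_smul_sub hR]
  rw [mem_closedBall, not_le] at hx
  exact (le_div_iff₀ hR).2 hx.le

lemma cutoff_eq_one (hR : 0 < R) {x : Rn n} (hx : x ∈ ball x₀ R) : cutoff x₀ R x = 1 := by
  refine (unitBump n).one_of_mem_closedBall ?_
  rw [mem_closedBall, dist_zero_right, norm_inv_smul_sub hR]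
  exact (div_le_one hR).2 (mem_ball.1 hx).le

lemma gradient_cutoff (x : Rn n) :
    gradient (cutoff x₀ R) x = R⁻¹ • gradient (unitBump n) (R⁻¹ • (x - x₀)) := by
  have h1 : HasFDerivAt (unitBump n) (fderiv ℝ (unitBump n) (R⁻¹ • (x - x₀))) (R⁻¹ • (x - x₀)) :=
    (((unitBump n).contDiff (n := 1)).differentiable (by simp) _).hasFDerivAt
  have h2 := h1.comp x (((hasFDerivAt_id x).sub_const x₀).const_smul R⁻¹)
  have h3 : fderiv ℝ (cutoff x₀ R) x = R⁻¹ • fderiv ℝ (unitBump n) (R⁻¹ • (x - x₀)) := by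
    have := h2.fderiv
    change fderiv ℝ (cutoff x₀ R) x = _ at this
    rw [this]; ext z; simp
  rw [gradient, h3, gradient, map_smulₛₗ]; simp

lemma gradient_cutoff_eq_zero (hR : 0 < R) {x : Rn n} (hx : x ∉ ball x₀ (2 * R) \ ball x₀ R) :
    gradient (cutoff x₀ R) x = 0 := by
  rw [gradient_cutoff, gradient_unitBump_eq_zero, smul_zero]
  rw [norm_inv_smul_sub hR, div_lt_one hR, le_div_iff₀ hR]
  by_contra! h
  exact hx ⟨h.2, fun h' => absurd (mem_ball.1 h') (not_lt.2 h.1)⟩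

/-- On an annulus where the exponent exceeds the dimension, the modular of the gradient of the
cut-off function decays. -/
lemma exists_integral_gradient_cutoff_le {p : Rn n → ℝ} {P : ℝ}
    (h1 : ∀ x, 1 ≤ p x) (hP : ∀ x, p x ≤ P) (δ : ℝ) (x₀ : Rn n) :
    ∃ C : ℝ, 0 ≤ C ∧ ∀ R : ℝ, 1 ≤ R →
      (((n : ℝ) + δ : ℝ) : EReal) ≤ pMinus p (ball x₀ (2 * R) \ ball x₀ R) →
      ∫ x, ‖gradient (cutoff x₀ R) x‖ ^ p x ≤ C * R ^ (-δ) := by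
  have ht : IsTestFunction univ (unitBump n) :=
    ⟨(unitBump n).contDiff, (unitBump n).hasCompactSupport, subset_univ _⟩
  obtain ⟨D, hD⟩ :=
    ht.hasCompactSupport_gradient.exists_bound_of_continuous ht.continuous_gradient
  set D' := max 1 D with hD'
  have hD1 : 1 ≤ D' := le_max_left _ _
  set v := (volume : Measure (Rn n)).real (ball 0 1) with hv
  refine ⟨D' ^ P * 2 ^ n * v, by positivity, fun R hR hann => ?_⟩
  have hR0 : 0 < R := by linarith
  set S := ball x₀ (2 * R) \ ball x₀ R with hS
  have hSm : MeasurableSet S := measurableSet_ball.diff measurableSet_ball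
  have hS_lt : volume S < ⊤ := (measure_mono sdiff_subset).trans_lt measure_ball_lt_top
  have hset : ∫ x, ‖gradient (cutoff x₀ R) x‖ ^ p x
      = ∫ x in S, ‖gradient (cutoff x₀ R) x‖ ^ p x := by
    refine (setIntegral_eq_integral_of_forall_compl_eq_zero fun x hx => ?_).symm
    rw [gradient_cutoff_eq_zero hR0 hx, norm_zero, Real.zero_rpow (by linarith [h1 x])]
  have hpt : ∀ᵐ x ∂volume.restrict S,
      ‖‖gradient (cutoff x₀ R) x‖ ^ p x‖ ≤ D' ^ P * R ^ (-((n : ℝ) + δ)) := by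
    filter_upwards [ae_le_of_le_pMinus hann] with x hx
    have hp0 : 0 ≤ p x := by linarith [h1 x]
    rw [Real.norm_of_nonneg (by positivity), gradient_cutoff, norm_smul, mul_comm,
      Real.norm_of_nonneg (inv_pos.2 hR0).le, Real.mul_rpow (norm_nonneg _) (by positivity),
      Real.inv_rpow hR0.le, ← Real.rpow_neg hR0.le]
    gcongr ?_ * ?_
    · calc _ ≤ D' ^ p x := by gcongr; exact (hD _).trans (le_max_right _ _)
        _ ≤ D' ^ P := Real.rpow_le_rpow_of_exponent_le hD1 (hP x)
    -- Here `R ≥ 1` turns the lower bound `p x ≥ n + δ` into an upper bound for `R ^ (-p x)`.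
    · exact Real.rpow_le_rpow_of_exponent_le hR (by linarith)
  rw [hset]
  refine (le_abs_self _).trans ((norm_setIntegral_le_of_norm_le_const_ae hS_lt hpt).trans ?_)
  have hvol : volume.real S ≤ (2 * R) ^ n * v := by
    refine (measureReal_mono sdiff_subset measure_ball_lt_top.ne).trans_eq ?_
    rw [Measure.real, Measure.addHaar_ball_of_pos _ _ (by positivity : 0 < 2 * R),
      finrank_euclideanSpace_fin, ENNReal.toReal_mul, ENNReal.toReal_ofReal (by positivity)]
    rfl
  calc _ ≤ D' ^ P * R ^ (-((n : ℝ) + δ)) * ((2 * R) ^ n * v) := by gcongr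
    _ = D' ^ P * 2 ^ n * v * (R ^ (-((n : ℝ) + δ)) * R ^ n) := by ring
    _ = _ := by
      rw [← Real.rpow_natCast R n, ← Real.rpow_add hR0]; congr 2; ring

end Cutoff

/-! ### From vanishing gradient to constancy, and the theorem -/

section Liouville

/-- A continuous function with vanishing weak gradient is constant. -/
lemma IsWeakGradient.exists_eq_const {u : Rn n → ℝ} {G : Rn n → Rn n}
    (hw : IsWeakGradient univ u G) (hu : Continuous u) (hG : G =ᵐ[volume] 0) :
    ∃ c, ∀ x, u x = c := by
  refine ⟨u 0, fun x => ?_⟩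
  -- Each mollification is smooth with zero gradient, hence constant; continuity of `u` then passes
  -- this to the limit at every point.
  have hk : ∀ k, mollify k u x = mollify k u 0 := fun k => by
    refine is_const_of_fderiv_eq_zero (𝕜 := ℝ)
      ((contDiff_mollify k hu.locallyIntegrable).differentiable (by simp)) (fun y => ?_) x 0
    have h0 : gradient (mollify k u) y = 0 := by
      rw [gradient_mollify hw, mollify_eq]
      refine integral_eq_zero_of_ae ?_
      filter_upwards [hG] with z hz
      simp [hz]
    simpa [gradient] using h0
  exact tendsto_nhds_unique (tendsto_mollify hu x) (by simpa only [hk] using tendsto_mollify hu 0)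

end Liouville

end VarExp

open VarExp in
theorem theorem3p3 (n : ℕ)
    -- a bounded log-Hölder continuous exponent on `ℝⁿ` with `1 < p⁻ ≤ p⁺ < ∞`
    (p : VarExp.Rn n → ℝ) (hp : VarExp.IsLogExponent Set.univ p)
    (hp_minus : 1 < VarExp.pMinus p Set.univ) (hp_plus : VarExp.pPlus p Set.univ < ⊤)
    -- an operator of `p(·)`-growth
    (A : VarExp.Rn n → ℝ → VarExp.Rn n → VarExp.Rn n)
    (hA : VarExp.HasVarGrowth Set.univ p A)
    -- the condition on the annuli, around a fixed centre `x₀`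
    (x₀ : VarExp.Rn n) (δ : ℝ) (hδ : 0 < δ) (R : ℕ → ℝ)
    (hR : Filter.Tendsto R Filter.atTop Filter.atTop)
    (hann : ∀ k, (((n : ℝ) + δ : ℝ) : EReal) ≤
      VarExp.pMinus p (Metric.ball x₀ (2 * R k) \ Metric.ball x₀ (R k)))
    -- a bounded `𝒜`-harmonic function on `ℝⁿ`
    (u : VarExp.Rn n → ℝ) (hu : VarExp.IsAHarmonic Set.univ p A u)
    (hbdd : ∃ M : ℝ, ∀ x, |u x| ≤ M) :
    ∃ c : ℝ, ∀ x, u x = c := by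
  obtain ⟨M, hM⟩ := hbdd
  have hpc := hp.continuous
  have h1 : ∀ x, 1 ≤ p x := fun x => hp.isVariableExponent.one_le x trivial
  obtain ⟨P, hP⟩ := exists_forall_le_of_pPlus_lt_top hpc hp_plus
  have huc : Continuous u := continuousOn_univ.1 hu.continuousOn
  obtain ⟨G, hsob, heq⟩ := hu.isWeakSolution
  have hw := hsob.isWeakGradient
  have hF := hsob.memLpVarLoc_grad.locallyIntegrable_rpow hpc h1 hP
  have hGm : AEStronglyMeasurable G :=
    (locallyIntegrableOn_univ.1 hw.locallyIntegrableOn_grad).aestronglyMeasurable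
  obtain ⟨a, b, a₀, b₀, -, -, ha₀, haa, hab, hbb, hcoer, hgrow⟩ := hA.bounds
  have hb₀ : 0 ≤ b₀ := by
    linarith [haa 0 trivial, hab 0 trivial, hbb 0 trivial]
  have hVm : AEStronglyMeasurable fun x => A x (u x) (G x) := by
    refine (aemeasurable_comp_of_caratheodory (f := fun x (q : ℝ × Rn n) => A x q.1 q.2)
      (g := fun x => (u x, G x)) (fun q => ?_) (fun x => hA.isCaratheodory.continuous x trivial)
      (huc.aestronglyMeasurable.prodMk hGm)).aestronglyMeasurable
    simpa using hA.isCaratheodory.aemeasurable q.1 q.2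
  obtain ⟨q, C, hC0, hC⟩ := exists_caccioppoli (V := fun x => A x (u x) (G x)) hpc h1 hP
    hp.logHolder huc hM hw hF ha₀ hb₀ hVm
    (fun x => (hgrow x trivial _ _).trans
      (mul_le_mul_of_nonneg_right (hbb x trivial) (by positivity)))
    (fun x => (mul_le_mul_of_nonneg_right (haa x trivial) (by positivity)).trans
      (hcoer x trivial _ _))
    (fun φ hφ => by simpa using heq φ hφ)
  obtain ⟨C', hC'0, hC'⟩ := exists_integral_gradient_cutoff_le h1 hP δ x₀
  -- With `r` fixed, every cut-off with `R k ≥ r` equals 1 on the ball, so the integral is bounded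
  -- by a multiple of `R k ^ (-δ)` for all large `k`.
  have hball : ∀ r : ℝ, ∫ x in ball x₀ r, ‖G x‖ ^ p x = 0 := fun r => by
    refine le_antisymm ?_ (integral_nonneg fun x => by positivity)
    have hlim : Tendsto (fun k => C * (C' * R k ^ (-δ))) atTop (nhds 0) := by
      simpa using (((tendsto_rpow_neg_atTop hδ).comp hR).const_mul C').const_mul C
    refine ge_of_tendsto hlim ?_
    filter_upwards [hR.eventually_ge_atTop 1, hR.eventually_ge_atTop r] with k hk1 hkr
    have hk0 : 0 < R k := by linarith
    obtain ⟨hi, hle⟩ := hC _ (isTestFunction_cutoff (x₀ := x₀) hk0)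
      (fun x => (unitBump n).nonneg) (fun x => (unitBump n).le_one)
    have hnn : ∀ x, 0 ≤ cutoff x₀ (R k) x := fun x => (unitBump n).nonneg
    calc ∫ x in ball x₀ r, ‖G x‖ ^ p x
        = ∫ x in ball x₀ r, cutoff x₀ (R k) x ^ q * ‖G x‖ ^ p x := by
          refine setIntegral_congr_fun measurableSet_ball fun x hx => ?_
          simp [cutoff_eq_one hk0 (ball_subset_ball hkr hx)]
      _ ≤ ∫ x, cutoff x₀ (R k) x ^ q * ‖G x‖ ^ p x :=
          setIntegral_le_integral hi (Eventually.of_forall fun x => by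
            have := hnn x
            simp only [Pi.zero_apply]; positivity)
      _ ≤ C * ∫ x, ‖gradient (cutoff x₀ (R k)) x‖ ^ p x := hle
      _ ≤ C * (C' * R k ^ (-δ)) := by gcongr; exact hC' _ hk1 (hann k)
  refine hw.exists_eq_const huc ?_
  have hae : ∀ᵐ x ∂volume, ∀ m : ℕ, x ∈ ball x₀ m → G x = 0 := by
    refine ae_all_iff.2 fun m => ?_
    rw [← ae_restrict_iff'₀ measurableSet_ball.nullMeasurableSet]
    have hint : IntegrableOn (fun x => ‖G x‖ ^ p x) (ball x₀ m) :=
      (hF.integrableOn_isCompact (isCompact_closedBall x₀ m)).mono_set ball_subset_closedBall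
    filter_upwards [(integral_eq_zero_iff_of_nonneg (fun x => by
      simp only [Pi.zero_apply]; positivity) hint).1 (hball m)] with x hx
    exact norm_eq_zero.1 ((Real.rpow_eq_zero (norm_nonneg _) (by linarith [h1 x])).1 hx)
  filter_upwards [hae] with x hx
  obtain ⟨m, hm⟩ := exists_nat_gt (dist x x₀)
  exact hx m hm
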